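/- Let $X=(X_t)_{t\ge 0}$ be a regular one-dimensional diffusion (a strong Markov process with continuous paths such that $\mathbf P_x(H_y<\infty)>0$ for all $x,y\in I$) on an interval $I\subseteq\mathbb R$ with left end point $l\ge-\infty$ and right end point $+\infty$. It is not killed inside $I$, but it may explode to $+\infty$ in finite time. Here $\mathbf P_x$ is the law of $X$ started at $x$ and $H_a:=\inf\{t\ge 0: X_t=a\}$. Let $S$ be a scale function of $X$, that is, $S$ is continuous and strictly increasing on $I$ and $$\mathbf P_x(H_b<H_a)=\frac{S(x)-S(a)}{S(b)-S(a)}\qquad\text{for } a\le x\le b \text{ in } I,\ a<b.$$ Suppose that $S$ is continuously differentiable in the interior of $I$, and write $S(l)$ and $S(+\infty)$ for its limits at the end points. Assume that $X$ belongs to Class 1 or to Class 2: * Class 1 (recurrent): $S(+\infty)=+\infty$, and either a) $S(l)=-\infty$, or b) $S(l)>-\infty$, $l>-\infty$, and $l$ is a reflecting boundary point (that is, $l\in I$ and the time spent at $l$ has a.s. Lebesgue measure zero); * Class 2 (transient): $S(+\infty)<+\infty$, and either a) or b) as above. Let $M_t:=\max_{0\le s\le t}X_s$ and $D^-_t:=\max_{0\le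 s\le t}(M_s-X_s)$. Then for all $x\in I$ and $\eta>x$ the hitting time $H_\eta$ is $\mathbf P_x$-a.s. finite, and the maximum drawdown before it satisfies, for every real $y$ with $0\le y\le \eta-l$, $$\mathbf P_x\bigl(D^-_{H_\eta}<y\bigr)=\exp\left(-\int_{x\vee(y+l)}^{\eta}\frac{dS(z)}{S(z)-S(z-y)}\right),$$ where $y+l=-\infty$ and $\eta-l=+\infty$ if $l=-\infty$, and for $y=0$ the integral is $+\infty$ and $\exp(-\infty)=0$. -/

import Mathlib

open MeasureTheory Set Filter Topology
open scoped NNReal ENNReal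

noncomputable section

/-- First hitting time `H_a = inf {t ≥ 0 : X_t = a}` of the real state `a`, equal to `⊤` if the
state `a` is never visited. -/
def hitTime {Ω : Type*} (X : ℝ≥0 → Ω → EReal) (a : ℝ) : Ω → WithTop ℝ≥0 :=
  hittingAfter X {(a : EReal)} 0

/-- Running maximum `M_t = max_{0 ≤ s ≤ t} X_s`. -/
def runningMax {Ω : Type*} (X : ℝ≥0 → Ω → EReal) (t : ℝ≥0) (ω : Ω) : EReal :=
  ⨆ s : ℝ≥0, ⨆ _ : s ≤ t, X s ω

/-- Maximum drawdown `D⁻_T = max_{0 ≤ s ≤ T} (M_s - X_s)` up to the time `T`. -/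
def maxDrawdown {Ω : Type*} (X : ℝ≥0 → Ω → EReal) (T : WithTop ℝ≥0) (ω : Ω) : EReal :=
  ⨆ s : ℝ≥0, ⨆ _ : (s : WithTop ℝ≥0) ≤ T, runningMax X s ω - X s ω

/-- Left end point `l ∈ [-∞, ∞)` of an interval of the real line. -/
def leftEnd (I : Set ℝ) : EReal := sInf ((fun z : ℝ => (z : EReal)) '' I)

/-- `(X, (P x)_{x ∈ I})` is a regular one-dimensional diffusion on an interval `I` whose right end
point is `+∞`, not killed inside `I`: a strong Markov family with continuous paths in which every
state can be reached from every state. The point `⊤ : EReal` is the cemetery; it can only be reached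
continuously, i.e. by an explosion `X_t → +∞` in finite time, after which the path stays there. The
lifetime is the first time at which `X_t = ⊤`. The measures `P x` with `x ∉ I` play no role. -/
structure IsRegularDiffusion {Ω : Type*} [MeasurableSpace Ω] (I : Set ℝ)
    (X : ℝ≥0 → Ω → EReal) (P : ℝ → Measure Ω) : Prop where
  interval : I.OrdConnected
  right_end : ¬ BddAbove I
  measurable : ∀ t, Measurable (X t)
  continuous : ∀ ω, Continuous fun t => X t ω
  state : ∀ t ω, X t ω = ⊤ ∨ ∃ z ∈ I, X t ω = (z : EReal)
  absorbed : ∀ s t ω, s ≤ t → X s ω = ⊤ → X t ω = ⊤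
  prob : ∀ x ∈ I, IsProbabilityMeasure (P x)
  start : ∀ x ∈ I, ∀ᵐ ω ∂P x, X 0 ω = (x : EReal)
  measurable_law : ∀ B : Set (ℝ≥0 → EReal), MeasurableSet B →
    Measurable fun x : I => P x {ω | (fun t => X t ω) ∈ B}
  /- For a stopping time `τ` of the filtration generated by `X` and `A ∈ F_τ` contained in the event
  that `τ` is smaller than the lifetime, the path after `τ` has on `A` the law of the path under
  `P (X_τ)`. -/
  strong_markov : ∀ x ∈ I, ∀ (τ : Ω → WithTop ℝ≥0)
    (hτ : IsStoppingTime (Filtration.natural X fun t => (measurable t).stronglyMeasurable) τ)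
    (A : Set Ω), MeasurableSet[hτ.measurableSpace] A →
    (∀ ω ∈ A, τ ω < ⊤ ∧ X ((τ ω).untopD 0) ω < ⊤) →
    ∀ B : Set (ℝ≥0 → EReal), MeasurableSet B →
      P x (A ∩ {ω | (fun t => X ((τ ω).untopD 0 + t) ω) ∈ B}) =
        ∫⁻ ω in A, P (X ((τ ω).untopD 0) ω).toReal {ω' | (fun t => X t ω') ∈ B} ∂P x
  regular : ∀ x ∈ I, ∀ y ∈ I, 0 < P x {ω | hitTime X y ω < ⊤}

/-- `S` is a scale function of the diffusion: continuous and strictly increasing on `I`, with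
`P_x(H_b < H_a) = (S x - S a) / (S b - S a)` for `a ≤ x ≤ b` in `I`, `a < b`. -/
structure IsScaleFunction {Ω : Type*} [MeasurableSpace Ω] (I : Set ℝ)
    (X : ℝ≥0 → Ω → EReal) (P : ℝ → Measure Ω) (S : ℝ → ℝ) : Prop where
  continuousOn : ContinuousOn S I
  strictMonoOn : StrictMonoOn S I
  exit_prob : ∀ a ∈ I, ∀ x ∈ I, ∀ b ∈ I, a ≤ x → x ≤ b → a < b →
    P x {ω | hitTime X b ω < hitTime X a ω} = ENNReal.ofReal ((S x - S a) / (S b - S a))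

/-- `S(l)`, the limit of the increasing function `S` at the left end point of `I`. -/
def scaleLeft (I : Set ℝ) (S : ℝ → ℝ) : EReal := ⨅ z ∈ I, (S z : EReal)

/-- `S(+∞)`, the limit of the increasing function `S` at the right end point `+∞` of `I`. -/
def scaleRight (I : Set ℝ) (S : ℝ → ℝ) : EReal := ⨆ z ∈ I, (S z : EReal)

/-- The left end point is (instantaneously) reflecting: it is finite, it belongs to the state space
`I` (so that by regularity it is hit and left again), and the time spent there has almost surely
Lebesgue measure zero. -/
def ReflectingLeft {Ω : Type*} [MeasurableSpace Ω] (I : Set ℝ)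
    (X : ℝ≥0 → Ω → EReal) (P : ℝ → Measure Ω) : Prop :=
  ∃ l : ℝ, IsLeast I l ∧
    ∀ x ∈ I, ∀ᵐ ω ∂P x, volume {t : ℝ | 0 ≤ t ∧ X t.toNNReal ω = (l : EReal)} = 0

/-- The condition at the left end point common to both classes: a) `S(l) = -∞`, or
b) `S(l) > -∞`, `l > -∞` and reflecting. -/
def LeftCondition {Ω : Type*} [MeasurableSpace Ω] (I : Set ℝ)
    (X : ℝ≥0 → Ω → EReal) (P : ℝ → Measure Ω) (S : ℝ → ℝ) : Prop :=
  scaleLeft I S = ⊥ ∨ (⊥ < scaleLeft I S ∧ ⊥ < leftEnd I ∧ ReflectingLeft I X P)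

/-- Class 1 (the recurrent diffusions): `S(+∞) = +∞`. Recurrence follows from the conditions on the
scale function and the left end point, so it is not listed as a separate assumption. -/
def IsClassOne {Ω : Type*} [MeasurableSpace Ω] (I : Set ℝ)
    (X : ℝ≥0 → Ω → EReal) (P : ℝ → Measure Ω) (S : ℝ → ℝ) : Prop :=
  scaleRight I S = ⊤ ∧ LeftCondition I X P S

/-- Class 2 (the transient diffusions): `S(+∞) < +∞`. Transience follows from the conditions on the
scale function and the left end point, so it is not listed as a separate assumption. -/
def IsClassTwo {Ω : Type*} [MeasurableSpace Ω] (I : Set ℝ)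
    (X : ℝ≥0 → Ω → EReal) (P : ℝ → Measure Ω) (S : ℝ → ℝ) : Prop :=
  scaleRight I S < ⊤ ∧ LeftCondition I X P S

/-- `∫_{x ∨ (y + l)}^η S(dz) / (S(z) - S(z - y)) ∈ [0, ∞]` for a continuously differentiable `S`. -/
def drawdownIntegral (I : Set ℝ) (S : ℝ → ℝ) (x η y : ℝ) : ℝ≥0∞ :=
  ∫⁻ z in {z : ℝ | max (x : EReal) ((y : EReal) + leftEnd I) < (z : EReal) ∧ z ≤ η},
    ENNReal.ofReal (deriv S z) / ENNReal.ofReal (S z - S (z - y))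

end

/-!
Fix the starting point `x` and the size `y > 0`, and let `F z` be the probability that all drawdowns
before the first visit to `z` are smaller than `y`. While the path climbs from `z` to `z' > z` its
running maximum lies between `z` and `z'`. Hence drawdowns stay below `y` if they do so up to `H_z`
and the path then reaches `z'` before `z' - y` (`DrawdownBelow.extend`), and only if they do so up
to `H_z` and the path then reaches `z'` before `z - y` (`DrawdownBelow.hitsBefore`). The strong
Markov property at `H_z` and the exit probabilities turn this into
`(S z - S (z' - y)) / (S z' - S (z' - y)) * F z ≤ F z'` and
`F z' ≤ (S z - S (z - y)) / (S z' - S (z - y)) * F z`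
(`le_measure_drawdownEvent`, `measure_drawdownEvent_le`).

Both sides have the same first order expansion as `z' ↓ z`, so that `F` is continuous with right
derivative `-F z * S' z / (S z - S (z - y))`, and `F` times the exponential of the integral of the
rate is constant (`eq_mul_exp_of_ratio_bounds`). With `c = x ∨ (y + l)`, no drawdown of size `y` is
possible before `H_c`, so `F c = 1`. The rate may be undefined at `c`, where `c - y` can be
a left end point outside `I`; the equation is integrated from points to the right of `c`, followed
by a passage to the limit (`exp_neg_lintegral_of_ratio_bounds`).

That `H_η` is finite almost surely follows from the exit probabilities if `S(l) = -∞`. Otherwise `l`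
is a state, and by regularity there is a time `T` such that `η` is reached within `T` with a
probability that is bounded away from zero over all starting points in `[l, η]`; the Markov property
at the multiples of `T` then gives a geometric bound (`measure_not_hitTime_le_pow`).

The strong Markov property is stated for measurable sets of arbitrary paths, and for the natural
filtration. The events above are not of this kind on the space of all paths, so they are replaced by
conditions on countably many times that agree with them for continuous paths.
-/

/-! ### Hitting times and drawdowns of a single path -/

/-- `T` is the first time at which the path `w` visits the real state `a`. -/
def IsFirstHit (w : ℝ≥0 → EReal) (a : ℝ) (T : ℝ≥0) : Prop :=
  w T = (a : EReal) ∧ ∀ s < T, w s ≠ (a : EReal)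

/-- The path `w` visits `b`, and does so before any visit to `a`. -/
def HitsBefore (w : ℝ≥0 → EReal) (b a : ℝ) : Prop :=
  ∃ t, w t = (b : EReal) ∧ ∀ s ≤ t, w s ≠ (a : EReal)

/-- The path `w` visits `z`, and all its drawdowns up to the first visit are smaller than `y`.
A path started at or below `z` is real-valued up to that visit, so that `EReal.toReal` is
harmless. -/
def DrawdownBelow (y z : ℝ) (w : ℝ≥0 → EReal) : Prop :=
  ∃ T, IsFirstHit w z T ∧ ∀ s u, s ≤ u → u ≤ T → (w s).toReal < (w u).toReal + y

section Path

variable {w : ℝ≥0 → EReal} {a b y z z' : ℝ} {s t T T' : ℝ≥0}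

theorem IsFirstHit.le_of_hit (h : IsFirstHit w a T) (ht : w t = a) : T ≤ t :=
  not_lt.1 fun hlt => h.2 t hlt ht

theorem IsFirstHit.unique (h : IsFirstHit w a T) (h' : IsFirstHit w a T') : T = T' :=
  le_antisymm (h.le_of_hit h'.1) (h'.le_of_hit h.1)

theorem isFirstHit_sInf (hw : Continuous w) (ht : w t = a) :
    IsFirstHit w a (sInf {s | w s = a}) := by
  have hcl : IsClosed {s | w s = (a : EReal)} := isClosed_eq hw continuous_const
  refine ⟨hcl.csInf_mem ⟨t, ht⟩ (OrderBot.bddBelow _), fun s hs h => ?_⟩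
  exact not_lt.2 (csInf_le (s := {s | w s = (a : EReal)}) (OrderBot.bddBelow _) h) hs

theorem exists_isFirstHit (hw : Continuous w) (ht : w t = a) :
    ∃ T ≤ t, IsFirstHit w a T :=
  ⟨_, (isFirstHit_sInf hw ht).le_of_hit ht, isFirstHit_sInf hw ht⟩

theorem exists_hit_of_le_of_le (hw : Continuous w) (h0 : w s ≤ z) (ht : z ≤ w t) (hst : s ≤ t) :
    ∃ u, s ≤ u ∧ u ≤ t ∧ w u = z := by
  obtain ⟨u, hu, h⟩ := intermediate_value_Icc hst hw.continuousOn ⟨h0, ht⟩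
  exact ⟨u, hu.1, hu.2, h⟩

theorem exists_hit_of_ge_of_ge (hw : Continuous w) (h0 : z ≤ w s) (ht : w t ≤ z) (hst : s ≤ t) :
    ∃ u, s ≤ u ∧ u ≤ t ∧ w u = z := by
  obtain ⟨u, hu, h⟩ := intermediate_value_Icc' hst hw.continuousOn ⟨ht, h0⟩
  exact ⟨u, hu.1, hu.2, h⟩

theorem IsFirstHit.lt (hw : Continuous w) (h0 : w 0 ≤ z) (h : IsFirstHit w z T) (hs : s < T) :
    w s < z := by
  by_contra! hle
  obtain ⟨u, -, hu, e⟩ := exists_hit_of_le_of_le hw h0 hle zero_le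
  exact h.2 u (hu.trans_lt hs) e

theorem IsFirstHit.le (hw : Continuous w) (h0 : w 0 ≤ z) (h : IsFirstHit w z T) (hs : s ≤ T) :
    w s ≤ z := by
  rcases hs.eq_or_lt with rfl | hs
  · exact h.1.le
  · exact (h.lt hw h0 hs).le

theorem IsFirstHit.coe_toReal (hw : Continuous w) (hbot : ∀ t, w t ≠ ⊥) (h0 : w 0 ≤ z)
    (h : IsFirstHit w z T) (hs : s ≤ T) : ((w s).toReal : EReal) = w s :=
  EReal.coe_toReal ((h.le hw h0 hs).trans_lt (EReal.coe_lt_top z)).ne (hbot s)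

theorem IsFirstHit.toReal_le (hw : Continuous w) (hbot : ∀ t, w t ≠ ⊥) (h0 : w 0 ≤ z)
    (h : IsFirstHit w z T) (hs : s ≤ T) : (w s).toReal ≤ z := by
  have := h.le hw h0 hs
  rw [← h.coe_toReal hw hbot h0 hs] at this
  exact_mod_cast this

theorem IsFirstHit.toReal_eq (h : IsFirstHit w z T) : (w T).toReal = z := by
  rw [h.1, EReal.toReal_coe]

theorem IsFirstHit.continuousOn_toReal (hw : Continuous w) (hbot : ∀ t, w t ≠ ⊥) (h0 : w 0 ≤ z)
    (h : IsFirstHit w z T) : ContinuousOn (fun s => (w s).toReal) (Iic T) := by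
  refine EReal.continuousOn_toReal.comp hw.continuousOn fun s hs => ?_
  simp only [mem_compl_iff, mem_insert_iff, mem_singleton_iff, not_or]
  exact ⟨hbot s, ((h.le hw h0 hs).trans_lt (EReal.coe_lt_top z)).ne⟩

/-- Strict pointwise bounds on the drawdown up to the first visit to `z` are uniform. -/
theorem IsFirstHit.exists_uniform_drawdown_bound (hw : Continuous w) (hbot : ∀ t, w t ≠ ⊥)
    (h0 : w 0 ≤ z)
    (hT : IsFirstHit w z T)
    (h : ∀ s u, s ≤ u → u ≤ T → (w s).toReal < (w u).toReal + y) :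
    ∃ q < y, ∀ s u, s ≤ u → u ≤ T → (w s).toReal ≤ (w u).toReal + q := by
  have hcont := hT.continuousOn_toReal hw hbot h0
  set K : Set (ℝ≥0 × ℝ≥0) := (Icc 0 T ×ˢ Icc 0 T) ∩ {p | p.1 ≤ p.2} with hK
  have hKc : IsCompact K :=
    (isCompact_Icc.prod isCompact_Icc).inter_right (isClosed_le continuous_fst continuous_snd)
  have hf : ContinuousOn (fun p : ℝ≥0 × ℝ≥0 => (w p.1).toReal - (w p.2).toReal) K :=
    (hcont.comp continuousOn_fst fun p hp => hp.1.1.2).sub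
      (hcont.comp continuousOn_snd fun p hp => hp.1.2.2)
  obtain ⟨p, hp, hmax⟩ := hKc.exists_isMaxOn ⟨(0, 0), by simp [hK]⟩ hf
  refine ⟨(w p.1).toReal - (w p.2).toReal, by have := h p.1 p.2 hp.2 hp.1.2.2; linarith,
    fun s u hsu hu => ?_⟩
  have := hmax (show (s, u) ∈ K from ⟨⟨⟨zero_le, hsu.trans hu⟩, ⟨zero_le, hu⟩⟩, hsu⟩)
  simp only [mem_ofPred_eq] at this
  linarith

theorem DrawdownBelow.mono (hw : Continuous w) (h0 : w 0 ≤ z) (hz : z ≤ z')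
    (h : DrawdownBelow y z' w) : DrawdownBelow y z w := by
  obtain ⟨T, hT, hd⟩ := h
  obtain ⟨u, -, hu, e⟩ := exists_hit_of_le_of_le hw h0
    (show (z : EReal) ≤ w T by rw [hT.1]; exact_mod_cast hz) zero_le
  obtain ⟨T', hT', hf⟩ := exists_isFirstHit hw e
  exact ⟨T', hf, fun s v hs hv => hd s v hs (hv.trans (hT'.trans hu))⟩

/-- A path with small drawdowns up to `z'` goes from `z` to `z'` without descending to `z - y`. -/
theorem DrawdownBelow.hitsBefore (hw : Continuous w) (h0 : w 0 ≤ z) (hz : z ≤ z')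
    (h : DrawdownBelow y z' w) (hT : IsFirstHit w z T) :
    HitsBefore (fun t => w (T + t)) z' (z - y) := by
  obtain ⟨T', hT', hd⟩ := h
  obtain ⟨u, -, hu, e⟩ := exists_hit_of_le_of_le hw h0
    (show (z : EReal) ≤ w T' by rw [hT'.1]; exact_mod_cast hz) zero_le
  have hle : T ≤ T' := (hT.le_of_hit e).trans hu
  refine ⟨T' - T, by simpa [add_tsub_cancel_of_le hle] using hT'.1, fun s hs e => ?_⟩
  have := hd T (T + s) le_self_add
    ((add_le_add_right hs T).trans (add_tsub_cancel_of_le hle).le)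
  rw [show w (T + s) = _ from e, hT.toReal_eq, EReal.toReal_coe] at this
  linarith

/-- Small drawdowns up to `z`, followed by a passage from `z` to `z'` that avoids `z' - y`, make
small drawdowns up to `z'`. -/
theorem DrawdownBelow.extend (hw : Continuous w) (hbot : ∀ t, w t ≠ ⊥) (h0 : w 0 ≤ z) (hz : z ≤ z')
    (hzy : z' - y < z) (h : DrawdownBelow y z w) (hT : IsFirstHit w z T)
    (hh : HitsBefore (fun t => w (T + t)) z' (z' - y)) : DrawdownBelow y z' w := by
  obtain ⟨T₁, hT₁, hd⟩ := h
  obtain rfl := hT.unique hT₁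
  obtain ⟨t, ht, hav⟩ := hh
  obtain ⟨T', hT't, hT'⟩ := exists_isFirstHit hw ht
  have h0' : w 0 ≤ z' := h0.trans (by exact_mod_cast hz)
  refine ⟨T', hT', fun s u hs hu => ?_⟩
  rcases le_total u T with huT | huT
  · exact hd s u hs huT
  have h1 := hT'.toReal_le hw hbot h0' (hs.trans hu)
  suffices z' - y < (w u).toReal by linarith
  by_contra! hle
  have hu' : w u ≤ ((z' - y : ℝ) : EReal) := by
    rw [← hT'.coe_toReal hw hbot h0' hu]; exact_mod_cast hle
  obtain ⟨v, hv1, hv2, e⟩ := exists_hit_of_ge_of_ge hw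
    (show ((z' - y : ℝ) : EReal) ≤ w T by rw [hT.1]; exact_mod_cast hzy.le) hu' huT
  refine hav (v - T) ?_ (by simpa [add_tsub_cancel_of_le hv1] using e)
  rw [tsub_le_iff_left]
  exact hv2.trans (hu.trans hT't)

theorem drawdownBelow_self (hy : 0 < y) (h0 : w 0 = z) : DrawdownBelow y z w := by
  refine ⟨0, ⟨h0, fun s hs => absurd hs (not_lt.2 zero_le)⟩, fun s u hs hu => ?_⟩
  obtain rfl : u = 0 := le_antisymm hu zero_le
  obtain rfl : s = 0 := le_antisymm hs zero_le
  linarith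

/-- A path bounded below by `a` has drawdowns smaller than `y` before it climbs above `a + y`. -/
theorem drawdownBelow_of_lower_bound (hw : Continuous w) (hbot : ∀ t, w t ≠ ⊥) (hy : 0 < y)
    (h0 : w 0 ≤ z) (ha : ∀ t, (a : EReal) ≤ w t) (haz : z ≤ a + y) (hit : w t = z) :
    DrawdownBelow y z w := by
  obtain ⟨T, -, hT⟩ := exists_isFirstHit hw hit
  refine ⟨T, hT, fun s u hs hu => ?_⟩
  have h1 : a ≤ (w u).toReal := by
    have := ha u
    rw [← hT.coe_toReal hw hbot h0 hu] at this
    exact_mod_cast this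
  rcases hu.eq_or_lt with rfl | hu
  · rw [hT.toReal_eq]
    linarith [hT.toReal_le hw hbot h0 hs]
  · have h2 := hT.lt hw h0 (hs.trans_lt hu)
    rw [← hT.coe_toReal hw hbot h0 (hs.trans hu.le)] at h2
    have h3 : (w s).toReal < z := by exact_mod_cast h2
    linarith

end Path

section HittingTime

variable {Ω : Type*} {X : ℝ≥0 → Ω → EReal} {ω : Ω} {a b y z : ℝ} {t T : ℝ≥0}

theorem hitTime_eq_top_iff : hitTime X a ω = ⊤ ↔ ∀ t, X t ω ≠ a := by
  simp [hitTime, hittingAfter_eq_top_iff]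

theorem hitTime_lt_top_iff : hitTime X a ω < ⊤ ↔ ∃ t, X t ω = a := by
  rw [lt_top_iff_ne_top, Ne, hitTime_eq_top_iff]; push Not; rfl

theorem IsFirstHit.hitTime_eq (hX : Continuous fun t => X t ω)
    (h : IsFirstHit (fun t => X t ω) a T) : hitTime X a ω = T := by
  have h' := isFirstHit_sInf hX h.1
  rw [hitTime, hittingAfter, if_pos ⟨T, zero_le, h.1⟩]
  simp only [zero_le, true_and, mem_singleton_iff]
  exact_mod_cast h'.unique h

theorem hitTime_le_iff (hX : Continuous fun t => X t ω) :
    hitTime X a ω ≤ t ↔ ∃ s ≤ t, X s ω = a := by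
  constructor
  · intro h
    obtain ⟨s, hs⟩ := hitTime_lt_top_iff.1 (h.trans_lt (WithTop.coe_lt_top t))
    obtain ⟨T, -, hT⟩ := exists_isFirstHit hX hs
    rw [hT.hitTime_eq hX] at h
    exact ⟨T, by exact_mod_cast h, hT.1⟩
  · rintro ⟨s, hs, e⟩
    obtain ⟨T, hTs, hT⟩ := exists_isFirstHit hX e
    rw [hT.hitTime_eq hX]
    exact_mod_cast hTs.trans hs

theorem hitTime_lt_hitTime_iff (hX : Continuous fun t => X t ω) :
    hitTime X b ω < hitTime X a ω ↔ HitsBefore (fun t => X t ω) b a := by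
  constructor
  · intro h
    obtain ⟨s, hs⟩ := hitTime_lt_top_iff.1 (h.trans_le le_top)
    obtain ⟨T, -, hT⟩ := exists_isFirstHit hX hs
    rw [hT.hitTime_eq hX] at h
    refine ⟨T, hT.1, fun s hs e => ?_⟩
    exact not_le.2 h ((hitTime_le_iff hX).2 ⟨s, hs, e⟩)
  · rintro ⟨t, ht, hav⟩
    have h1 : hitTime X b ω ≤ t := (hitTime_le_iff hX).2 ⟨t, le_rfl, ht⟩
    refine h1.trans_lt (not_le.1 fun h => ?_)
    obtain ⟨s, hs, e⟩ := (hitTime_le_iff hX).1 h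
    exact hav s hs e

theorem maxDrawdown_lt_iff (hX : Continuous fun t => X t ω) (hbot : ∀ t, X t ω ≠ ⊥)
    (h0 : X 0 ω ≤ z) (hit : hitTime X z ω < ⊤) :
    maxDrawdown X (hitTime X z ω) ω < y ↔ DrawdownBelow y z (fun t => X t ω) := by
  obtain ⟨s, hs⟩ := hitTime_lt_top_iff.1 hit
  obtain ⟨T, -, hT⟩ := exists_isFirstHit hX hs
  rw [hT.hitTime_eq hX]
  constructor
  · refine fun h => ⟨T, hT, fun s u hs hu => ?_⟩
    have h1 : runningMax X u ω - X u ω < y :=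
      (le_iSup₂_of_le (f := fun (s : ℝ≥0) (_ : (s : WithTop ℝ≥0) ≤ T) =>
        runningMax X s ω - X s ω) u (by exact_mod_cast hu) le_rfl).trans_lt h
    have h2 : X s ω ≤ runningMax X u ω :=
      le_iSup₂_of_le (f := fun (s : ℝ≥0) (_ : s ≤ u) => X s ω) s hs le_rfl
    have h3 := (EReal.sub_le_sub h2 le_rfl).trans_lt h1
    rw [← hT.coe_toReal hX hbot h0 (hs.trans hu), ← hT.coe_toReal hX hbot h0 hu] at h3
    have h4 : (X s ω).toReal - (X u ω).toReal < y := by exact_mod_cast h3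
    linarith
  · rintro ⟨T', hT', h⟩
    obtain rfl := hT.unique hT'
    obtain ⟨q, hq, hd⟩ := IsFirstHit.exists_uniform_drawdown_bound hX hbot h0 hT h
    refine lt_of_le_of_lt (iSup₂_le fun u hu => ?_) (show (q : EReal) < y by exact_mod_cast hq)
    have hu' : u ≤ T := by exact_mod_cast hu
    have e := hT.coe_toReal hX hbot h0 hu'
    have h1 : runningMax X u ω ≤ (((X u ω).toReal + q : ℝ) : EReal) := by
      refine iSup₂_le fun s hs => ?_
      rw [← hT.coe_toReal hX hbot h0 (hs.trans hu')]
      exact_mod_cast hd s u hs hu'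
    refine (EReal.sub_le_sub h1 le_rfl).trans ?_
    rw [← e, EReal.toReal_coe, ← EReal.coe_sub]
    exact_mod_cast (by linarith)

theorem maxDrawdown_nonneg (h : X 0 ω = z) (T : WithTop ℝ≥0) : 0 ≤ maxDrawdown X T ω := by
  refine le_iSup₂_of_le (f := fun (s : ℝ≥0) (_ : (s : WithTop ℝ≥0) ≤ T) =>
        runningMax X s ω - X s ω) 0 (by simp) ?_
  have h2 : X 0 ω ≤ runningMax X 0 ω :=
    le_iSup₂_of_le (f := fun (s : ℝ≥0) (_ : s ≤ 0) => X s ω) 0 le_rfl le_rfl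
  refine le_trans ?_ (EReal.sub_le_sub h2 le_rfl)
  rw [h, ← EReal.coe_sub]
  simp

end HittingTime

/-! ### Measurability of hitting events -/

/-- A measurable set of paths that a continuous path belongs to exactly when it visits `a` during
`[0, t]`; only the values at countably many times matter. -/
def hitByCylinder (a : ℝ) (t : ℝ≥0) : Set (ℝ≥0 → EReal) :=
  {w | ∀ p q : ℚ, (p : ℝ) < a → a < (q : ℝ) → ∃ k, w (TopologicalSpace.denseSeq (Iic t) k) ∈
    Ioo ((p : ℝ) : EReal) ((q : ℝ) : EReal)}

theorem mem_hitByCylinder_iff {w : ℝ≥0 → EReal} (hw : Continuous w) {a : ℝ} {t : ℝ≥0} :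
    w ∈ hitByCylinder a t ↔ ∃ s ≤ t, w s = a := by
  have hf : Continuous fun s : Iic t => w s := hw.comp continuous_subtype_val
  have : CompactSpace (Iic t) := isCompact_iff_compactSpace.1 (by
    rw [← Icc_bot]; exact isCompact_Icc)
  constructor
  · intro h
    by_contra! hne
    have hK : IsClosed (range fun s : Iic t => w s) := (isCompact_range hf).isClosed
    have hmem : (range fun s : Iic t => w s)ᶜ ∈ 𝓝 (a : EReal) := by
      refine hK.isOpen_compl.mem_nhds ?_
      rintro ⟨s, hs⟩
      exact hne s s.2 hs
    obtain ⟨l, u, ⟨hl, hu⟩, hsub⟩ := (mem_nhds_iff_exists_Ioo_subset' ⟨⊥, EReal.bot_lt_coe a⟩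
      ⟨⊤, EReal.coe_lt_top a⟩).1 hmem
    obtain ⟨p, hp1, hp2⟩ := EReal.lt_iff_exists_rat_btwn.1 hl
    obtain ⟨q, hq1, hq2⟩ := EReal.lt_iff_exists_rat_btwn.1 hu
    obtain ⟨k, hk⟩ := h p q (by exact_mod_cast hp2) (by exact_mod_cast hq1)
    exact hsub ⟨hp1.trans hk.1, hk.2.trans hq2⟩ ⟨_, rfl⟩
  · rintro ⟨s, hs, e⟩ p q hp hq
    have ho : IsOpen ((fun s : Iic t => w s) ⁻¹' Ioo ((p : ℝ) : EReal) ((q : ℝ) : EReal)) :=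
      isOpen_Ioo.preimage hf
    obtain ⟨k, hk⟩ := (TopologicalSpace.denseRange_denseSeq (Iic t)).exists_mem_open ho
      ⟨⟨s, hs⟩, by
        simp only [mem_preimage, e, mem_Ioo]
        exact ⟨by exact_mod_cast hp, by exact_mod_cast hq⟩⟩
    exact ⟨k, hk⟩

theorem measurableSet_mem_hitByCylinder {Ω : Type*} {m : MeasurableSpace Ω} {X : ℝ≥0 → Ω → EReal}
    {a : ℝ} {t : ℝ≥0} (hX : ∀ s ≤ t, Measurable (X s)) :
    MeasurableSet {ω | (fun s => X s ω) ∈ hitByCylinder a t} := by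
  simp only [hitByCylinder, mem_ofPred_eq]
  simp only [ofPred_forall, ofPred_exists]
  refine MeasurableSet.iInter fun p => MeasurableSet.iInter fun q => MeasurableSet.iInter fun _ =>
    MeasurableSet.iInter fun _ => MeasurableSet.iUnion fun k => ?_
  exact hX _ (TopologicalSpace.denseSeq (Iic t) k).2 measurableSet_Ioo

/-- A measurable set of paths that a continuous path belongs to exactly when it visits `b` before
`a`. -/
def hitsBeforeCylinder (b a : ℝ) : Set (ℝ≥0 → EReal) :=
  ⋃ n : ℕ, hitByCylinder b (TopologicalSpace.denseSeq ℝ≥0 n) \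
    hitByCylinder a (TopologicalSpace.denseSeq ℝ≥0 n)

theorem measurableSet_hitByCylinder (a : ℝ) (t : ℝ≥0) : MeasurableSet (hitByCylinder a t) :=
  measurableSet_mem_hitByCylinder (X := fun s (w : ℝ≥0 → EReal) => w s)
    fun s _ => measurable_pi_apply s

theorem measurableSet_hitsBeforeCylinder (b a : ℝ) : MeasurableSet (hitsBeforeCylinder b a) :=
  MeasurableSet.iUnion fun _ =>
    (measurableSet_hitByCylinder _ _).diff (measurableSet_hitByCylinder _ _)

theorem mem_hitsBeforeCylinder_iff {w : ℝ≥0 → EReal} (hw : Continuous w) {b a : ℝ} :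
    w ∈ hitsBeforeCylinder b a ↔ HitsBefore w b a := by
  simp only [hitsBeforeCylinder, mem_iUnion, Set.mem_sdiff, mem_hitByCylinder_iff hw]
  constructor
  · rintro ⟨n, ⟨t, ht, e⟩, hav⟩
    exact ⟨t, e, fun s hs h => hav ⟨s, hs.trans ht, h⟩⟩
  · rintro ⟨t, e, hav⟩
    obtain ⟨u, htu, hu⟩ : ∃ u, t < u ∧ ∀ s < u, w s ≠ a := by
      by_cases h : ∃ s, w s = a
      · obtain ⟨s, hs⟩ := h
        obtain ⟨T, -, hT⟩ := exists_isFirstHit hw hs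
        exact ⟨T, not_le.1 fun h => hav T h hT.1, hT.2⟩
      · push Not at h
        exact ⟨t + 1, lt_add_one t, fun s _ => h s⟩
    obtain ⟨_, ⟨n, rfl⟩, h1, h2⟩ :=
      (TopologicalSpace.denseRange_denseSeq ℝ≥0).exists_between htu
    exact ⟨n, ⟨t, h1.le, e⟩, fun ⟨s, hs, h⟩ => hu s (hs.trans_lt h2) h⟩

/-! ### The strong Markov property at a hitting time -/

namespace IsRegularDiffusion

variable {Ω : Type*} [MeasurableSpace Ω] {I : Set ℝ} {X : ℝ≥0 → Ω → EReal} {P : ℝ → Measure Ω}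
  {S : ℝ → ℝ} {x y z z' a b : ℝ}

theorem ne_bot (hX : IsRegularDiffusion I X P) (t : ℝ≥0) (ω : Ω) : X t ω ≠ ⊥ := by
  rcases hX.state t ω with h | ⟨z, -, h⟩ <;> simp [h]

theorem mem_of_le (hX : IsRegularDiffusion I X P) (hx : x ∈ I) (h : x ≤ z) : z ∈ I := by
  obtain ⟨u, hu, hzu⟩ := not_bddAbove_iff.1 hX.right_end z
  exact hX.interval.out hx hu ⟨h, hzu.le⟩

theorem continuous_shift (hX : IsRegularDiffusion I X P) (s : ℝ≥0) (ω : Ω) :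
    Continuous fun t => X (s + t) ω :=
  (hX.continuous ω).comp (continuous_const.add continuous_id)

/-- The natural filtration of a diffusion. -/
noncomputable abbrev filtration (hX : IsRegularDiffusion I X P) :
    Filtration ℝ≥0 (inferInstance : MeasurableSpace Ω) :=
  Filtration.natural X fun t => (hX.measurable t).stronglyMeasurable

theorem measurable_filtration (hX : IsRegularDiffusion I X P) {s t : ℝ≥0} (hst : s ≤ t) :
    Measurable[hX.filtration t] (X s) :=
  (comap_measurable (X s)).mono
    (le_iSup₂_of_le (f := fun j (_ : j ≤ t) => MeasurableSpace.comap (X j) _) s hst le_rfl) le_rfl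

theorem isStoppingTime_hitTime (hX : IsRegularDiffusion I X P) (a : ℝ) :
    IsStoppingTime hX.filtration (hitTime X a) := by
  intro t
  have : {ω | hitTime X a ω ≤ t} = {ω | (fun s => X s ω) ∈ hitByCylinder a t} := by
    ext ω
    exact (hitTime_le_iff (hX.continuous ω)).trans (mem_hitByCylinder_iff (hX.continuous ω)).symm
  rw [this]
  exact measurableSet_mem_hitByCylinder fun s hs => hX.measurable_filtration hs

/-- On an event of the past of `H_z`, on which `z` is visited, the path after `H_z` is independent
of the past and has the law `P z`. -/
theorem measure_inter_shift_hitTime (hX : IsRegularDiffusion I X P) (hx : x ∈ I) {A : Set Ω}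
    (hA : MeasurableSet[(hX.isStoppingTime_hitTime z).measurableSpace] A)
    (hAz : ∀ ω ∈ A, hitTime X z ω < ⊤) {B : Set (ℝ≥0 → EReal)} (hB : MeasurableSet B) :
    P x (A ∩ {ω | (fun t => X ((hitTime X z ω).untopD 0 + t) ω) ∈ B}) =
      P z {ω | (fun t => X t ω) ∈ B} * P x A := by
  have key : ∀ ω ∈ A, X ((hitTime X z ω).untopD 0) ω = z := by
    intro ω hω
    obtain ⟨t, ht⟩ := hitTime_lt_top_iff.1 (hAz ω hω)
    obtain ⟨T, -, hT⟩ := exists_isFirstHit (hX.continuous ω) ht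
    rw [hT.hitTime_eq (hX.continuous ω)]
    exact hT.1
  rw [hX.strong_markov x hx _ (hX.isStoppingTime_hitTime z) A hA
    (fun ω hω => ⟨hAz ω hω, by rw [key ω hω]; exact EReal.coe_lt_top z⟩) B hB]
  have hAm : MeasurableSet A := (hX.isStoppingTime_hitTime z).measurableSpace_le _ hA
  rw [setLIntegral_congr_fun (g := fun _ => P z {ω | (fun t => X t ω) ∈ B}) hAm
    fun ω hω => by simp only [key ω hω, EReal.toReal_coe], setLIntegral_const]

end IsRegularDiffusion

/-! ### The drawdown event and its conditional probabilities -/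

/-- The paths that start from `x` and have drawdowns smaller than `y` up to the first visit to
`z`. -/
def drawdownEvent {Ω : Type*} (X : ℝ≥0 → Ω → EReal) (x y z : ℝ) : Set Ω :=
  {ω | X 0 ω = x ∧ DrawdownBelow y z fun t => X t ω}

namespace IsRegularDiffusion

variable {Ω : Type*} [MeasurableSpace Ω] {I : Set ℝ} {X : ℝ≥0 → Ω → EReal} {P : ℝ → Measure Ω}
  {S : ℝ → ℝ} {x y z z' a b : ℝ}

/-- By continuity, the drawdown event is determined at countably many times before `t`, on the
event that `z` is visited before `t`. -/
theorem drawdownEvent_inter_eq (hX : IsRegularDiffusion I X P) (hy : 0 < y) (hxz : x ≤ z)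
    (t : ℝ≥0) :
    drawdownEvent X x y z ∩ {ω | hitTime X z ω ≤ t} = {ω | X 0 ω = x} ∩ {ω | hitTime X z ω ≤ t} ∩
      ⋃ q : ℚ, ⋃ _ : (q : ℝ) < y, ⋂ i : ℕ, ⋂ j : ℕ,
      ⋂ _ : TopologicalSpace.denseSeq (Iic t) i ≤ TopologicalSpace.denseSeq (Iic t) j,
        ({ω | hitTime X z ω ≤ (TopologicalSpace.denseSeq (Iic t) j : ℝ≥0)} ∪
        {ω | (X (TopologicalSpace.denseSeq (Iic t) i) ω).toReal ≤
          (X (TopologicalSpace.denseSeq (Iic t) j) ω).toReal + q}) := by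
  set d := TopologicalSpace.denseSeq (Iic t)
  have hd : DenseRange d := TopologicalSpace.denseRange_denseSeq _
  ext ω
  have hw := hX.continuous ω
  have hbot := fun t => hX.ne_bot t ω
  simp only [drawdownEvent, mem_inter_iff, mem_ofPred_eq, mem_iUnion, mem_iInter, mem_union,
    exists_prop]
  constructor
  · rintro ⟨⟨h0, T, hT, h⟩, hle⟩
    refine ⟨⟨h0, hle⟩, ?_⟩
    obtain ⟨q, hq, hu⟩ := IsFirstHit.exists_uniform_drawdown_bound hw hbot
      (by rw [h0]; exact_mod_cast hxz) hT h
    obtain ⟨r, hr1, hr2⟩ := exists_rat_btwn hq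
    refine ⟨r, hr2, fun i j hij => ?_⟩
    rw [hT.hitTime_eq hw]
    rcases le_total T (d j) with h | h
    · exact Or.inl (by exact_mod_cast h)
    · exact Or.inr ((hu _ _ hij h).trans (by linarith))
  · rintro ⟨⟨h0, hle⟩, q, hq, hall⟩
    refine ⟨⟨h0, ?_⟩, hle⟩
    obtain ⟨s, -, hs⟩ := (hitTime_le_iff hw).1 hle
    obtain ⟨T, -, hT⟩ := exists_isFirstHit hw hs
    rw [hT.hitTime_eq hw] at hle hall
    have hTt : T ≤ t := by exact_mod_cast hle
    have h0' : X 0 ω ≤ z := by rw [h0]; exact_mod_cast hxz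
    refine ⟨T, hT, fun s u hs hu => ?_⟩
    rcases hu.eq_or_lt with rfl | hu
    · rw [hT.toReal_eq]
      linarith [hT.toReal_le hw hbot h0' hs]
    rcases hs.eq_or_lt with rfl | hs
    · linarith
    by_contra! hcon
    have hct : ∀ v : Iic t, (v : ℝ≥0) < T → ContinuousAt (fun v : Iic t => (X v ω).toReal) v :=
      fun v hv => ((hT.continuousOn_toReal hw hbot h0').continuousAt (Iic_mem_nhds hv)).comp
        continuous_subtype_val.continuousAt
    let p : Iic t × Iic t := (⟨s, (hs.trans hu).le.trans hTt⟩, ⟨u, hu.le.trans hTt⟩)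
    have hev : ∀ᶠ r in 𝓝 p, r.1 < r.2 ∧ (r.2 : ℝ≥0) < T ∧
        (X r.2 ω).toReal + q < (X r.1 ω).toReal := by
      refine (continuousAt_fst.eventually_lt continuousAt_snd hs).and
        (((continuous_subtype_val.comp continuous_snd).continuousAt.eventually_lt
          continuousAt_const hu).and ?_)
      have c1 : ContinuousAt (fun r : Iic t × Iic t => (X r.2 ω).toReal) p :=
        ContinuousAt.comp (f := Prod.snd) (hct p.2 hu) continuousAt_snd
      have c2 : ContinuousAt (fun r : Iic t × Iic t => (X r.1 ω).toReal) p :=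
        ContinuousAt.comp (f := Prod.fst) (hct p.1 (hs.trans hu)) continuousAt_fst
      exact (c1.add continuousAt_const).eventually_lt c2
        (show (X u ω).toReal + q < (X s ω).toReal by linarith)
    obtain ⟨_, hr, ⟨⟨i, j⟩, rfl⟩⟩ := mem_closure_iff_nhds.1 ((hd.prodMap hd) p) _ hev
    obtain ⟨h1, h2, h3⟩ := hr
    rcases hall i j h1.le with h | h
    · exact absurd h2 (not_lt.2 (by exact_mod_cast h))
    · exact absurd h3 (not_lt.2 h)

theorem measurableSet_drawdownEvent (hX : IsRegularDiffusion I X P) (hy : 0 < y) (hxz : x ≤ z) :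
    MeasurableSet[(hX.isStoppingTime_hitTime z).measurableSpace] (drawdownEvent X x y z) := by
  have hle : ∀ t, MeasurableSet[hX.filtration t]
      (drawdownEvent X x y z ∩ {ω | hitTime X z ω ≤ t}) := by
    intro t
    rw [hX.drawdownEvent_inter_eq hy hxz t]
    refine MeasurableSet.inter (MeasurableSet.inter ?_ (hX.isStoppingTime_hitTime z t)) ?_
    · exact hX.measurable_filtration zero_le (measurableSet_singleton _)
    refine MeasurableSet.iUnion fun q => MeasurableSet.iUnion fun _ => MeasurableSet.iInter fun i =>
      MeasurableSet.iInter fun j => MeasurableSet.iInter fun _ => MeasurableSet.union ?_ ?_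
    · exact hX.filtration.mono (TopologicalSpace.denseSeq (Iic t) j).2 _
        (hX.isStoppingTime_hitTime z _)
    · have h (i : ℕ) := (hX.measurable_filtration
        (TopologicalSpace.denseSeq (Iic t) i).2).ereal_toReal
      exact measurableSet_le (h i) ((h j).add_const _)
  refine ⟨?_, hle⟩
  have : drawdownEvent X x y z =
      ⋃ n : ℕ, drawdownEvent X x y z ∩ {ω | hitTime X z ω ≤ (n : ℝ≥0)} := by
    refine Subset.antisymm (fun ω hω => ?_) (iUnion_subset fun n => inter_subset_left)
    obtain ⟨T, hT, -⟩ := hω.2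
    obtain ⟨n, hn⟩ := exists_nat_ge T
    refine mem_iUnion.2 ⟨n, hω, ?_⟩
    rw [mem_ofPred_eq, hT.hitTime_eq (hX.continuous ω)]
    exact_mod_cast hn
  rw [this]
  exact MeasurableSet.iUnion fun n => (le_iSup hX.filtration (n : ℝ≥0)) _ (hle n)

theorem measure_drawdownEvent_inter (hX : IsRegularDiffusion I X P) (hS : IsScaleFunction I X P S)
    (hx : x ∈ I) (hy : 0 < y) (hxz : x ≤ z) (hzz' : z ≤ z') (ha : a ∈ I) (haz : a < z) :
    P x (drawdownEvent X x y z ∩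
      {ω | HitsBefore (fun t => X ((hitTime X z ω).untopD 0 + t) ω) z' a}) =
    ENNReal.ofReal ((S z - S a) / (S z' - S a)) * P x (drawdownEvent X x y z) := by
  have hz : z ∈ I := hX.mem_of_le hx hxz
  rw [← hS.exit_prob a ha z hz z' (hX.mem_of_le hz hzz') haz.le hzz' (haz.trans_le hzz')]
  have h1 : {ω | HitsBefore (fun t => X ((hitTime X z ω).untopD 0 + t) ω) z' a} =
      {ω | (fun t => X ((hitTime X z ω).untopD 0 + t) ω) ∈ hitsBeforeCylinder z' a} := by
    ext ω
    exact (mem_hitsBeforeCylinder_iff (hX.continuous_shift _ ω)).symm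
  have h2 : {ω | hitTime X z' ω < hitTime X a ω} =
      {ω | (fun t => X t ω) ∈ hitsBeforeCylinder z' a} := by
    ext ω
    exact (hitTime_lt_hitTime_iff (hX.continuous ω)).trans
      (mem_hitsBeforeCylinder_iff (hX.continuous ω)).symm
  rw [h1, h2]
  refine hX.measure_inter_shift_hitTime hx (hX.measurableSet_drawdownEvent hy hxz) ?_
    (measurableSet_hitsBeforeCylinder _ _)
  rintro ω ⟨-, T, hT, -⟩
  exact hitTime_lt_top_iff.2 ⟨T, hT.1⟩

theorem measure_drawdownEvent_le (hX : IsRegularDiffusion I X P) (hS : IsScaleFunction I X P S)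
    (hx : x ∈ I) (hy : 0 < y) (hxz : x ≤ z) (hzz' : z ≤ z') (ha : z - y ∈ I) :
    P x (drawdownEvent X x y z') ≤
      ENNReal.ofReal ((S z - S (z - y)) / (S z' - S (z - y))) * P x (drawdownEvent X x y z) := by
  rw [← hX.measure_drawdownEvent_inter hS hx hy hxz hzz' ha (by linarith)]
  refine measure_mono ?_
  rintro ω ⟨h0, h⟩
  have h0' : X 0 ω ≤ z := by rw [h0]; exact_mod_cast hxz
  have hm := h.mono (hX.continuous ω) h0' hzz'
  refine ⟨⟨h0, hm⟩, ?_⟩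
  obtain ⟨T, hT, -⟩ := hm
  simp only [mem_ofPred_eq, hT.hitTime_eq (hX.continuous ω)]
  exact h.hitsBefore (hX.continuous ω) h0' hzz' hT

theorem le_measure_drawdownEvent (hX : IsRegularDiffusion I X P) (hS : IsScaleFunction I X P S)
    (hx : x ∈ I) (hy : 0 < y) (hxz : x ≤ z) (hzz' : z ≤ z') (ha : z' - y ∈ I) (hz : z' - y < z) :
    ENNReal.ofReal ((S z - S (z' - y)) / (S z' - S (z' - y))) * P x (drawdownEvent X x y z) ≤
      P x (drawdownEvent X x y z') := by
  rw [← hX.measure_drawdownEvent_inter hS hx hy hxz hzz' ha hz]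
  refine measure_mono ?_
  rintro ω ⟨⟨h0, h⟩, hh⟩
  have h0' : X 0 ω ≤ z := by rw [h0]; exact_mod_cast hxz
  obtain ⟨T, hT, hd⟩ := id h
  simp only [mem_ofPred_eq, hT.hitTime_eq (hX.continuous ω)] at hh
  exact ⟨h0, h.extend (hX.continuous ω) (fun t => hX.ne_bot t ω) h0' hzz' hz hT hh⟩

end IsRegularDiffusion

/-! ### Almost sure finiteness of the hitting times of higher states -/

theorem setOf_hitTime_lt_top {Ω : Type*} (X : ℝ≥0 → Ω → EReal) (a : ℝ) :
    {ω | hitTime X a ω < ⊤} = ⋃ n : ℕ, {ω | hitTime X a ω ≤ (n : ℝ≥0)} := by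
  ext ω
  simp only [mem_ofPred_eq, mem_iUnion]
  constructor
  · intro h
    lift hitTime X a ω to ℝ≥0 using h.ne with T
    obtain ⟨n, hn⟩ := exists_nat_ge T
    exact ⟨n, by exact_mod_cast hn⟩
  · rintro ⟨n, hn⟩
    exact hn.trans_lt (WithTop.coe_lt_top _)

namespace IsRegularDiffusion

variable {Ω : Type*} [MeasurableSpace Ω] {I : Set ℝ} {X : ℝ≥0 → Ω → EReal} {P : ℝ → Measure Ω}
  {S : ℝ → ℝ} {x y z η l a b : ℝ}

theorem measurableSet_hitTime_le (hX : IsRegularDiffusion I X P) (a : ℝ) (t : ℝ≥0) :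
    MeasurableSet {ω | hitTime X a ω ≤ t} :=
  hX.filtration.le t _ (hX.isStoppingTime_hitTime a t)

theorem measurableSet_hitTime_lt_top (hX : IsRegularDiffusion I X P) (a : ℝ) :
    MeasurableSet {ω | hitTime X a ω < ⊤} := by
  rw [setOf_hitTime_lt_top]
  exact MeasurableSet.iUnion fun n => hX.measurableSet_hitTime_le a n

/-- If `S(l) = -∞` then the lower exit probabilities tend to zero, so `η` is reached. -/
theorem ae_hitTime_lt_top_of_scaleLeft_eq_bot (hX : IsRegularDiffusion I X P)
    (hS : IsScaleFunction I X P S) (hl : scaleLeft I S = ⊥) (hx : x ∈ I) (hxη : x < η) :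
    ∀ᵐ ω ∂P x, hitTime X η ω < ⊤ := by
  have := hX.prob x hx
  have hη : η ∈ I := hX.mem_of_le hx hxη.le
  refine (mem_ae_iff_prob_eq_one (hX.measurableSet_hitTime_lt_top η)).2 (le_antisymm prob_le_one ?_)
  refine le_of_forall_lt fun c hc => ?_
  have hc' : c.toReal < 1 := by
    rw [← ENNReal.toReal_one]
    exact (ENNReal.toReal_lt_toReal hc.ne_top ENNReal.one_ne_top).2 hc
  obtain ⟨r, hr1, hr2⟩ := exists_between hc'
  have hSx : S x < S η := hS.strictMonoOn hx hη hxη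
  have hr0 : 0 < 1 - r := by linarith
  obtain ⟨a, ha, hSa⟩ : ∃ a ∈ I, S a < S η - (S η - S x) / (1 - r) := by
    have h : scaleLeft I S < ((S η - (S η - S x) / (1 - r) : ℝ) : EReal) := by
      rw [hl]; exact EReal.bot_lt_coe _
    simp only [scaleLeft, iInf_lt_iff] at h
    obtain ⟨a, ha, h⟩ := h
    exact ⟨a, ha, by exact_mod_cast h⟩
  have hle : S η - S x ≤ (S η - S x) / (1 - r) := by
    rw [le_div_iff₀ hr0]
    have : 0 ≤ r := ENNReal.toReal_nonneg.trans hr1.le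
    nlinarith
  have hax : a < x := (hS.strictMonoOn.lt_iff_lt ha hx).1 (by linarith)
  have hp := hS.exit_prob a ha x hx η hη hax.le hxη.le (hax.trans hxη)
  calc c = ENNReal.ofReal c.toReal := (ENNReal.ofReal_toReal hc.ne_top).symm
    _ < ENNReal.ofReal ((S x - S a) / (S η - S a)) := by
        have hpos : 0 < S η - S a := by linarith
        have h1 : r ≤ (S x - S a) / (S η - S a) := by
          rw [le_div_iff₀ hpos]
          have h2 : (S η - S x) / (1 - r) ≤ S η - S a := by linarith
          rw [div_le_iff₀ hr0] at h2
          linarith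
        exact (ENNReal.ofReal_lt_ofReal_iff_of_nonneg ENNReal.toReal_nonneg).2 (hr1.trans_le h1)
    _ = P x {ω | hitTime X η ω < hitTime X a ω} := hp.symm
    _ ≤ P x {ω | hitTime X η ω < ⊤} := measure_mono fun ω hω =>
        show hitTime X η ω < ⊤ from lt_of_lt_of_le hω le_top

/-- Since paths from `l` to `η` pass through `z ∈ [l, η]`, reaching `η` from `l` takes
stochastically longer than from `z`. -/
theorem measure_hitTime_le_mono (hX : IsRegularDiffusion I X P) (hl : l ∈ I) (hlz : l ≤ z)
    (hzη : z ≤ η) (t : ℝ≥0) :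
    P l {ω | hitTime X η ω ≤ t} ≤ P z {ω | hitTime X η ω ≤ t} := by
  have := hX.prob l hl
  have hA : MeasurableSet[(hX.isStoppingTime_hitTime z).measurableSpace]
      {ω | hitTime X z ω < ⊤} := by
    rw [setOf_hitTime_lt_top]
    exact MeasurableSet.iUnion fun n => (hX.isStoppingTime_hitTime z).measurableSet_le' n
  have key := hX.measure_inter_shift_hitTime hl hA (fun ω h => h)
    (measurableSet_hitByCylinder η t)
  have h1 : {ω | hitTime X η ω ≤ t} = {ω | (fun s => X s ω) ∈ hitByCylinder η t} := by
    ext ω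
    exact (hitTime_le_iff (hX.continuous ω)).trans (mem_hitByCylinder_iff (hX.continuous ω)).symm
  calc P l {ω | hitTime X η ω ≤ t}
      ≤ P l ({ω | hitTime X z ω < ⊤} ∩
        {ω | (fun s => X ((hitTime X z ω).untopD 0 + s) ω) ∈ hitByCylinder η t}) := by
        refine measure_mono_ae ?_
        filter_upwards [hX.start l hl] with ω h0 hω
        have hc := hX.continuous ω
        obtain ⟨s, hs, e⟩ := (hitTime_le_iff hc).1 hω
        obtain ⟨u, -, hu, e'⟩ := exists_hit_of_le_of_le hc (z := z) (s := 0) (t := s)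
          (by rw [h0]; exact_mod_cast hlz) (by rw [e]; exact_mod_cast hzη) zero_le
        obtain ⟨T, hTu, hT⟩ := exists_isFirstHit hc e'
        refine ⟨hitTime_lt_top_iff.2 ⟨u, e'⟩, ?_⟩
        rw [mem_ofPred_eq, mem_hitByCylinder_iff (hX.continuous_shift _ ω),
          hT.hitTime_eq hc]
        refine ⟨s - T, tsub_le_self.trans hs, ?_⟩
        change X (T + (s - T)) ω = η
        rwa [add_tsub_cancel_of_le (hTu.trans hu)]
    _ = P z {ω | (fun s => X s ω) ∈ hitByCylinder η t} * P l {ω | hitTime X z ω < ⊤} := key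
    _ ≤ P z {ω | hitTime X η ω ≤ t} := by
        rw [h1]
        exact mul_le_of_le_one_right' prob_le_one

/-- Each period of length `T` brings a new chance of reaching `η`, by the Markov property. -/
theorem measure_not_hitTime_le_pow (hX : IsRegularDiffusion I X P) (hl : IsLeast I l)
    (T : ℝ≥0) (k : ℕ) (hz : z ∈ I) (hzη : z ≤ η) :
    P z {ω | ¬ hitTime X η ω ≤ (k * T : ℝ≥0)} ≤ (1 - P l {ω | hitTime X η ω ≤ T}) ^ k := by
  induction k generalizing z with
  | zero => have := hX.prob z hz; simpa using prob_le_one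
  | succ k ih =>
    have := hX.prob z hz
    set A : Set Ω := {ω | X 0 ω = z} ∩ {ω | hitTime X η ω ≤ T}ᶜ
    have hAF : MeasurableSet[hX.filtration T] A :=
      (hX.measurable_filtration zero_le (measurableSet_singleton _)).inter
        (hX.isStoppingTime_hitTime η T).compl
    have hAm : MeasurableSet A := hX.filtration.le T _ hAF
    have hAlt : ∀ ω ∈ A, X T ω < η := by
      rintro ω ⟨h0, h⟩
      by_contra! hle
      obtain ⟨u, -, hu, e⟩ := exists_hit_of_le_of_le (hX.continuous ω) (z := η) (s := 0) (t := T)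
        (by rw [h0]; exact_mod_cast hzη) hle zero_le
      exact h ((hitTime_le_iff (hX.continuous ω)).2 ⟨u, hu, e⟩)
    have hcyl : ∀ t : ℝ≥0, {ω | ¬ hitTime X η ω ≤ t} =
        {ω | (fun s => X s ω) ∈ (hitByCylinder η t)ᶜ} := by
      intro t
      ext ω
      exact not_congr ((hitTime_le_iff (hX.continuous ω)).trans
        (mem_hitByCylinder_iff (hX.continuous ω)).symm)
    have key := hX.strong_markov z hz _ (isStoppingTime_const hX.filtration T) A
      (by rw [IsStoppingTime.measurableSpace_const hX.filtration T]; exact hAF)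
      (fun ω hω => ⟨WithTop.coe_lt_top T, (hAlt ω hω).trans (EReal.coe_lt_top η)⟩)
      _ (measurableSet_hitByCylinder η (k * T)).compl
    simp only [WithTop.untopD_coe] at key
    calc P z {ω | ¬ hitTime X η ω ≤ ((k + 1 : ℕ) * T : ℝ≥0)}
        ≤ P z (A ∩ {ω | (fun t => X (T + t) ω) ∈ (hitByCylinder η (k * T))ᶜ}) := by
          refine measure_mono_ae ?_
          filter_upwards [hX.start z hz] with ω h0 hω
          have hc := hX.continuous ω
          refine ⟨⟨h0, fun h => hω ?_⟩, fun h => hω ?_⟩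
          · refine le_trans h ?_
            have : T ≤ ((k + 1 : ℕ) * T : ℝ≥0) := le_mul_of_one_le_left zero_le (by simp)
            exact_mod_cast this
          · rw [mem_hitByCylinder_iff (hX.continuous_shift _ ω)] at h
            obtain ⟨s, hs, e⟩ := h
            refine (hitTime_le_iff hc).2 ⟨T + s, ?_, e⟩
            calc T + s ≤ T + k * T := by gcongr
              _ = _ := by push_cast; ring
      _ = ∫⁻ ω in A, P (X T ω).toReal {ω' | (fun t => X t ω') ∈ (hitByCylinder η (k * T))ᶜ} ∂P z :=
          key
      _ ≤ ∫⁻ _ in A, (1 - P l {ω | hitTime X η ω ≤ T}) ^ k ∂P z := by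
          refine setLIntegral_mono' hAm fun ω hω => ?_
          rw [← hcyl]
          have hlt := hAlt ω hω
          rcases hX.state T ω with h | ⟨v, hv, h⟩
          · exact absurd hlt (by simp [h])
          · rw [h] at hlt ⊢
            rw [EReal.toReal_coe]
            exact ih hv (by exact_mod_cast hlt.le)
      _ = (1 - P l {ω | hitTime X η ω ≤ T}) ^ k * P z A := setLIntegral_const _ _
      _ ≤ (1 - P l {ω | hitTime X η ω ≤ T}) ^ (k + 1) := by
          rw [pow_succ]
          gcongr
          refine (measure_mono inter_subset_right).trans ?_
          rw [prob_compl_eq_one_sub (hX.measurableSet_hitTime_le η T)]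
          exact tsub_le_tsub_left (hX.measure_hitTime_le_mono hl.1 (hl.2 hz) hzη T) 1

/-- If the left end point is a state, then regularity makes the chance of reaching `η` within some
fixed time uniformly positive, so `η` is reached. -/
theorem ae_hitTime_lt_top_of_isLeast (hX : IsRegularDiffusion I X P) (hl : IsLeast I l)
    (hx : x ∈ I) (hxη : x < η) : ∀ᵐ ω ∂P x, hitTime X η ω < ⊤ := by
  have := hX.prob l hl.1
  obtain ⟨n, hn⟩ : ∃ n : ℕ, 0 < P l {ω | hitTime X η ω ≤ (n : ℝ≥0)} := by
    by_contra! h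
    have h0 := hX.regular l hl.1 η (hX.mem_of_le hx hxη.le)
    rw [setOf_hitTime_lt_top, measure_iUnion_null fun n => le_antisymm (h n) zero_le] at h0
    exact h0.false
  have hlt : 1 - P l {ω | hitTime X η ω ≤ (n : ℝ≥0)} < 1 :=
    ENNReal.sub_lt_self ENNReal.one_ne_top one_ne_zero hn.ne'
  rw [ae_iff]
  refine le_antisymm (ge_of_tendsto' (ENNReal.tendsto_pow_atTop_nhds_zero_of_lt_one hlt)
    fun k => ?_) zero_le
  refine (measure_mono fun ω hω => ?_).trans (hX.measure_not_hitTime_le_pow hl n k hx hxη.le)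
  exact fun h => hω (h.trans_lt (WithTop.coe_lt_top _))

theorem ae_hitTime_lt_top (hX : IsRegularDiffusion I X P) (hS : IsScaleFunction I X P S)
    (hl : LeftCondition I X P S) (hx : x ∈ I) (hxη : x < η) :
    ∀ᵐ ω ∂P x, hitTime X η ω < ⊤ := by
  rcases hl with h | ⟨-, -, l, hl, -⟩
  · exact hX.ae_hitTime_lt_top_of_scaleLeft_eq_bot hS h hx hxη
  · exact hX.ae_hitTime_lt_top_of_isLeast hl hx hxη

end IsRegularDiffusion

/-! ### The differential equation for the drawdown probabilities -/

section ODE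

variable {S F : ℝ → ℝ} {y c d η z : ℝ}

/-- The two ratio bounds have the same first order expansion as `z' ↓ z`. -/
theorem hasDerivWithinAt_of_ratio_bounds (hy : 0 < y) (hSc : ContinuousOn S (Ioi (d - y)))
    (hSm : StrictMonoOn S (Ioi (d - y))) (hz : d < z) (hzη : z < η)
    (hSd : HasDerivAt S (deriv S z) z)
    (up : ∀ z', z < z' → z' ≤ η → F z' ≤ (S z - S (z - y)) / (S z' - S (z - y)) * F z)
    (lo : ∀ z', z < z' → z' ≤ η → z' - y < z →
      (S z - S (z' - y)) / (S z' - S (z' - y)) * F z ≤ F z') :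
    HasDerivWithinAt F (-(F z * (deriv S z / (S z - S (z - y))))) (Ici z) z := by
  rw [← hasDerivWithinAt_Ioi_iff_Ici, hasDerivWithinAt_iff_tendsto_slope' self_notMem_Ioi]
  have hslope : Tendsto (slope S z) (𝓝[>] z) (𝓝 (deriv S z)) :=
    (hasDerivAt_iff_tendsto_slope.1 hSd).mono_left
      (nhdsWithin_mono _ fun v (hv : z < v) => hv.ne')
  have hSz : Tendsto S (𝓝[>] z) (𝓝 (S z)) := hSd.continuousAt.tendsto.mono_left nhdsWithin_le_nhds
  have hSy : Tendsto (fun v => S (v - y)) (𝓝[>] z) (𝓝 (S (z - y))) := by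
    have h1 : ContinuousAt S (z - y) := hSc.continuousAt (Ioi_mem_nhds (by linarith))
    have h2 : ContinuousAt (fun v => S (v - y)) z :=
      ContinuousAt.comp (f := fun v => v - y) h1 (by fun_prop)
    exact h2.tendsto.mono_left nhdsWithin_le_nhds
  have hne : S z - S (z - y) ≠ 0 :=
    (sub_pos.2 (hSm (by simp; linarith) (by simp; linarith) (by linarith))).ne'
  have hlim : ∀ D : ℝ → ℝ, Tendsto D (𝓝[>] z) (𝓝 (S z - S (z - y))) →
      Tendsto (fun v => -(F z * (slope S z v / D v))) (𝓝[>] z)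
        (𝓝 (-(F z * (deriv S z / (S z - S (z - y)))))) := fun D hD =>
    ((hslope.div hD hne).const_mul (F z)).neg
  refine tendsto_of_tendsto_of_tendsto_of_le_of_le' (hlim _ (hSz.sub hSy))
    (hlim _ (hSz.sub tendsto_const_nhds)) ?_ ?_
  · filter_upwards [Ioo_mem_nhdsGT (lt_min hzη (lt_add_of_pos_right z hy))] with v hv
    have hvy : v < z + y := hv.2.trans_le (min_le_right _ _)
    have hpos : 0 < S v - S (v - y) :=
      sub_pos.2 (hSm (by simp; linarith [hv.1]) (by simp; linarith [hv.1]) (by linarith))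
    have h := lo v hv.1 (hv.2.le.trans (min_le_left _ _)) (by linarith)
    have hv' : 0 < v - z := sub_pos.2 hv.1
    rw [slope_def_field, slope_def_field, le_div_iff₀ hv']
    refine le_trans (le_of_eq ?_) (sub_le_sub_right h (F z))
    field_simp
    ring
  · filter_upwards [Ioo_mem_nhdsGT hzη] with v hv
    have hpos : 0 < S v - S (z - y) :=
      sub_pos.2 (hSm (by simp; linarith [hv.1]) (by simp; linarith [hv.1]) (by linarith [hv.1]))
    have h := up v hv.1 hv.2.le
    have hv' : 0 < v - z := sub_pos.2 hv.1
    rw [slope_def_field, slope_def_field, div_le_iff₀ hv']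
    refine (sub_le_sub_right h (F z)).trans (le_of_eq ?_)
    field_simp
    ring

theorem continuousOn_of_ratio_bounds (hy : 0 < y) (hSc : ContinuousOn S (Ioi (d - y)))
    (hSm : StrictMonoOn S (Ioi (d - y))) (hc : d < c)
    (hF0 : ∀ z ∈ Icc c η, 0 ≤ F z) (hF1 : ∀ z ∈ Icc c η, F z ≤ 1)
    (up : ∀ z z', c ≤ z → z < z' → z' ≤ η →
      F z' ≤ (S z - S (z - y)) / (S z' - S (z - y)) * F z)
    (lo : ∀ z z', c ≤ z → z < z' → z' ≤ η → z' - y < z →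
      (S z - S (z' - y)) / (S z' - S (z' - y)) * F z ≤ F z') :
    ContinuousOn F (Icc c η) := by
  rcases lt_or_ge η c with hlt | hcη
  · rw [Icc_eq_empty (not_le.2 hlt)]; exact continuousOn_empty F
  have hD : ContinuousOn (fun z => S z - S (z - y)) (Icc c η) := by
    refine (hSc.mono fun z hz => ?_).sub (hSc.comp (by fun_prop) fun z hz => ?_)
    · simp only [mem_Ioi]; linarith [hz.1]
    · simp only [mem_Ioi]; linarith [hz.1]
  obtain ⟨m, hm, hmin⟩ := isCompact_Icc.exists_isMinOn ⟨c, le_rfl, hcη⟩ hD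
  set δ := S m - S (m - y)
  have hδ : 0 < δ := sub_pos.2 (hSm (by simp only [mem_Ioi]; linarith [hm.1])
    (by simp only [mem_Ioi]; linarith [hm.1]) (by linarith))
  have key : ∀ z z', c ≤ z → z ≤ z' → z' ≤ η → z' - y < z → |F z' - F z| ≤ |S z' - S z| / δ := by
    intro z z' hz hzz' hz' hzy
    rcases hzz'.eq_or_lt with rfl | hlt
    · simp
    have hS1 : S z < S z' := hSm (by simp only [mem_Ioi]; linarith)
      (by simp only [mem_Ioi]; linarith) hlt
    have hpos : 0 < S z' - S (z - y) := sub_pos.2 (hSm (by simp only [mem_Ioi]; linarith)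
      (by simp only [mem_Ioi]; linarith) (by linarith))
    have hδ' : δ ≤ S z' - S (z' - y) := hmin ⟨hz.trans hzz', hz'⟩
    have hpos' : 0 < S z' - S (z' - y) := hδ.trans_le hδ'
    have h0 := hF0 z ⟨hz, hzz'.trans hz'⟩
    have h1 := hF1 z ⟨hz, hzz'.trans hz'⟩
    have hle : F z' ≤ F z := by
      refine (up z z' hz hlt hz').trans (mul_le_of_le_one_left h0 ?_)
      rw [div_le_one hpos]; linarith
    have hge : F z - F z' ≤ (S z' - S z) / (S z' - S (z' - y)) := by
      have h := lo z z' hz hlt hz' hzy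
      have e : (S z - S (z' - y)) / (S z' - S (z' - y)) =
          1 - (S z' - S z) / (S z' - S (z' - y)) := by field_simp; ring
      have h2 : 0 ≤ (S z' - S z) / (S z' - S (z' - y)) := div_nonneg (by linarith) hpos'.le
      rw [e] at h
      nlinarith
    rw [abs_sub_comm, abs_of_nonneg (sub_nonneg.2 hle), abs_of_pos (sub_pos.2 hS1)]
    exact hge.trans (div_le_div_of_nonneg_left (by linarith) hδ hδ')
  intro z₀ hz₀
  have hS0 : Tendsto (fun v => |S v - S z₀| / δ) (𝓝[Icc c η] z₀) (𝓝 0) := by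
    have h : ContinuousWithinAt S (Icc c η) z₀ :=
      (hSc.mono fun z hz => by simp only [mem_Ioi]; linarith [hz.1]) z₀ hz₀
    have := ((h.sub continuousWithinAt_const).abs.div_const δ).tendsto (f := fun v =>
      |S v - S z₀| / δ)
    simpa using this
  refine tendsto_iff_dist_tendsto_zero.2 (squeeze_zero' (Eventually.of_forall fun _ => dist_nonneg)
    ?_ hS0)
  have hball : Ioo (z₀ - y) (z₀ + y) ∈ 𝓝 z₀ := Ioo_mem_nhds (by linarith) (by linarith)
  filter_upwards [self_mem_nhdsWithin, mem_nhdsWithin_of_mem_nhds hball] with v hv hvy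
  rw [Real.dist_eq]
  rcases le_total z₀ v with h | h
  · exact key z₀ v hz₀.1 h hv.2 (by linarith [hvy.2])
  · rw [abs_sub_comm, abs_sub_comm (S v)]
    exact key v z₀ hv.1 h hz₀.2 (by linarith [hvy.1])

/-- The ratio bounds determine `F` as the solution of `F' = -F S' / (S - S (· - y))`. -/
theorem eq_mul_exp_of_ratio_bounds (hy : 0 < y) (hSc : ContinuousOn S (Ioi (d - y)))
    (hSm : StrictMonoOn S (Ioi (d - y))) (hSd : ∀ z, d < z → HasDerivAt S (deriv S z) z)
    (hSd' : ContinuousOn (deriv S) (Ioi d)) (hc : d < c) (hcη : c ≤ η)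
    (hF0 : ∀ z ∈ Icc c η, 0 ≤ F z) (hF1 : ∀ z ∈ Icc c η, F z ≤ 1)
    (up : ∀ z z', c ≤ z → z < z' → z' ≤ η →
      F z' ≤ (S z - S (z - y)) / (S z' - S (z - y)) * F z)
    (lo : ∀ z z', c ≤ z → z < z' → z' ≤ η → z' - y < z →
      (S z - S (z' - y)) / (S z' - S (z' - y)) * F z ≤ F z') :
    IntervalIntegrable (fun z => deriv S z / (S z - S (z - y))) volume c η ∧
    F η = F c * Real.exp (-∫ z in c..η, deriv S z / (S z - S (z - y))) := by
  set g : ℝ → ℝ := fun z => deriv S z / (S z - S (z - y)) with hg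
  have hgc : ContinuousOn g (Icc c η) := by
    refine (hSd'.mono fun z hz => hc.trans_le hz.1).div ((hSc.mono fun z hz => ?_).sub
      (hSc.comp (by fun_prop) fun z hz => ?_)) fun z hz => ?_
    · simp only [mem_Ioi]; linarith [hz.1]
    · simp only [mem_Ioi]; linarith [hz.1]
    · exact (sub_pos.2 (hSm (by simp only [mem_Ioi]; linarith [hz.1])
        (by simp only [mem_Ioi]; linarith [hz.1]) (by linarith))).ne'
  -- A globally continuous extension of `g` has a primitive that is differentiable everywhere.
  set h : ℝ → ℝ := IccExtend hcη ((Icc c η).domRestrict g)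
  have hh : Continuous h := (continuousOn_iff_continuous_domRestrict.1 hgc).Icc_extend'
  have hhg : EqOn h g (Icc c η) := fun z hz => IccExtend_of_mem _ _ hz
  have hint : ∫ z in c..η, g z = ∫ z in c..η, h z :=
    intervalIntegral.integral_congr fun z hz => (hhg (by rwa [uIcc_of_le hcη] at hz)).symm
  have hG : ∀ z, HasDerivAt (fun v => ∫ u in c..v, h u) (h z) z := fun z =>
    (hh.integral_hasStrictDerivAt c z).hasDerivAt
  have hconst := constant_of_has_deriv_right_zero (a := c) (b := η)
    (f := fun z => F z * Real.exp (∫ u in c..z, h u))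
    ((continuousOn_of_ratio_bounds hy hSc hSm hc hF0 hF1 up lo).mul
      (fun z _ => ((hG z).continuousAt.rexp).continuousWithinAt))
    (fun z hz => by
      have h1 := hasDerivWithinAt_of_ratio_bounds hy hSc hSm (hc.trans_le hz.1) hz.2
        (hSd z (hc.trans_le hz.1)) (fun z' => up z z' hz.1) (fun z' => lo z z' hz.1)
      refine (h1.mul (hG z).exp.hasDerivWithinAt).congr_deriv ?_
      rw [hhg ⟨hz.1, hz.2.le⟩]
      ring) η ⟨hcη, le_rfl⟩
  refine ⟨hgc.intervalIntegrable_of_Icc hcη, ?_⟩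
  simp only [intervalIntegral.integral_same, Real.exp_zero, mul_one] at hconst
  rw [hint, ← hconst, mul_assoc, ← Real.exp_add]
  simp

/-- The solution that starts from `1` at `c`, where the rate `S' / (S - S (· - y))` is only assumed
to make sense to the right of `c`. -/
theorem exp_neg_lintegral_of_ratio_bounds (hy : 0 < y) (hSc : ContinuousOn S (Ioi (c - y)))
    (hSm : StrictMonoOn S (Ioi (c - y))) (hSd : ∀ z, c < z → HasDerivAt S (deriv S z) z)
    (hSd' : ContinuousOn (deriv S) (Ioi c)) (hcη : c < η)
    (hF0 : ∀ z ∈ Icc c η, 0 ≤ F z) (hF1 : ∀ z ∈ Icc c η, F z ≤ 1) (hFc : F c = 1)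
    (up : ∀ z z', c < z → z < z' → z' ≤ η →
      F z' ≤ (S z - S (z - y)) / (S z' - S (z - y)) * F z)
    (lo : ∀ z z', c ≤ z → z < z' → z' ≤ η → z' - y < z →
      (S z - S (z' - y)) / (S z' - S (z' - y)) * F z ≤ F z') :
    ENNReal.ofReal (F η) = EReal.exp (-((∫⁻ z in Ioc c η,
      ENNReal.ofReal (deriv S z) / ENNReal.ofReal (S z - S (z - y)) : ℝ≥0∞) : EReal)) := by
  set G : ℝ → ℝ≥0∞ := fun z => ENNReal.ofReal (deriv S z) / ENNReal.ofReal (S z - S (z - y))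
  have hpos : ∀ z, c < z → 0 < S z - S (z - y) := fun z hz => sub_pos.2
    (hSm (by simp only [mem_Ioi]; linarith) (by simp only [mem_Ioi]; linarith) (by linarith))
  have hd0 : ∀ z, c < z → 0 ≤ deriv S z := by
    intro z hz
    rw [← derivWithin_of_isOpen isOpen_Ioi hz]
    exact (hSm.monotoneOn.mono (Ioi_subset_Ioi (by linarith))).derivWithin_nonneg
  obtain ⟨u, hu, hul, hlim⟩ := exists_seq_strictAnti_tendsto' hcη
  -- Away from `c` the equation can be integrated.
  have hstep : ∀ n, ENNReal.ofReal (F η) = ENNReal.ofReal (F (u n)) *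
      EReal.exp (-((∫⁻ z in Ioc (u n) η, G z : ℝ≥0∞) : EReal)) := by
    intro n
    have hcu : c < u n := (hul n).1
    obtain ⟨hi, he⟩ := eq_mul_exp_of_ratio_bounds hy hSc hSm hSd hSd' hcu (hul n).2.le
      (fun z hz => hF0 z ⟨hcu.le.trans hz.1, hz.2⟩) (fun z hz => hF1 z ⟨hcu.le.trans hz.1, hz.2⟩)
      (fun z z' h => up z z' (hcu.trans_le h)) (fun z z' h => lo z z' (hcu.le.trans h))
    have hJ : ∫⁻ z in Ioc (u n) η, G z =
        ENNReal.ofReal (∫ z in (u n)..η, deriv S z / (S z - S (z - y))) := by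
      rw [intervalIntegral.integral_of_le (hul n).2.le, ofReal_integral_eq_lintegral_ofReal
        ((intervalIntegrable_iff_integrableOn_Ioc_of_le (hul n).2.le).1 hi)]
      · refine setLIntegral_congr_fun measurableSet_Ioc fun z hz => ?_
        exact (ENNReal.ofReal_div_of_pos (hpos z (hcu.trans hz.1))).symm
      · refine (ae_restrict_iff' measurableSet_Ioc).2 (Eventually.of_forall fun z hz => ?_)
        exact div_nonneg (hd0 z (hcu.trans hz.1)) (hpos z (hcu.trans hz.1)).le
    have hnn : 0 ≤ ∫ z in (u n)..η, deriv S z / (S z - S (z - y)) :=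
      intervalIntegral.integral_nonneg (hul n).2.le fun z hz =>
        div_nonneg (hd0 z (hcu.trans_le hz.1)) (hpos z (hcu.trans_le hz.1)).le
    rw [hJ, EReal.coe_ennreal_ofReal, max_eq_left hnn, ← EReal.coe_neg, EReal.exp_coe,
      ← ENNReal.ofReal_mul (hF0 _ ⟨hcu.le, (hul n).2.le⟩), ← he]
  have hFu : Tendsto (fun n => ENNReal.ofReal (F (u n))) atTop (𝓝 1) := by
    rw [← ENNReal.ofReal_one]
    refine ENNReal.tendsto_ofReal ?_
    -- The state `c - y / 2` bounds `S (u n - y)` from above.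
    set δ := S c - S (c - y / 2)
    have hδ : 0 < δ := sub_pos.2 (hSm (by simp only [mem_Ioi]; linarith)
      (by simp only [mem_Ioi]; linarith) (by linarith))
    have hSu : Tendsto (fun n => S (u n)) atTop (𝓝 (S c)) :=
      (hSc.continuousAt (Ioi_mem_nhds (by linarith))).tendsto.comp hlim
    have hl : Tendsto (fun n => 1 - (S (u n) - S c) / δ) atTop (𝓝 1) := by
      simpa using ((hSu.sub_const (S c)).div_const δ).const_sub 1
    refine tendsto_of_tendsto_of_tendsto_of_le_of_le' hl tendsto_const_nhds ?_
      (Eventually.of_forall fun n => hF1 _ ⟨(hul n).1.le, (hul n).2.le⟩)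
    filter_upwards [hlim.eventually_lt_const (show c < c + y / 2 by linarith)] with n hn
    have hcu : c < u n := (hul n).1
    have h := lo c (u n) le_rfl hcu (hul n).2.le (by linarith)
    rw [hFc, mul_one] at h
    refine le_trans ?_ h
    have hp := hpos (u n) hcu
    have h1 : S (u n - y) < S (c - y / 2) := hSm (by simp only [mem_Ioi]; linarith)
      (by simp only [mem_Ioi]; linarith) (by linarith)
    have h2 : S c < S (u n) := hSm (by simp only [mem_Ioi]; linarith)
      (by simp only [mem_Ioi]; linarith) hcu
    have e : (S c - S (u n - y)) / (S (u n) - S (u n - y)) =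
        1 - (S (u n) - S c) / (S (u n) - S (u n - y)) := by field_simp; ring
    rw [e]
    refine sub_le_sub_left (div_le_div_of_nonneg_left (by linarith) hδ ?_) 1
    simp only [δ]; linarith
  have hJ : Tendsto (fun n => ∫⁻ z in Ioc (u n) η, G z) atTop (𝓝 (∫⁻ z in Ioc c η, G z)) := by
    have hU : Ioc c η = ⋃ n, Ioc (u n) η := by
      ext z
      simp only [mem_iUnion, mem_Ioc]
      constructor
      · rintro ⟨h1, h2⟩
        obtain ⟨n, hn⟩ := (hlim.eventually_lt_const h1).exists
        exact ⟨n, hn, h2⟩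
      · rintro ⟨n, h1, h2⟩
        exact ⟨(hul n).1.trans h1, h2⟩
    have := tendsto_measure_iUnion_atTop (μ := volume.withDensity G)
      (s := fun n => Ioc (u n) η) fun m n hmn => Ioc_subset_Ioc_left (hu.antitone hmn)
    rw [← hU] at this
    simpa only [Function.comp_def, withDensity_apply _ measurableSet_Ioc] using this
  have hE : Tendsto (fun n => EReal.exp (-((∫⁻ z in Ioc (u n) η, G z : ℝ≥0∞) : EReal))) atTop
      (𝓝 (EReal.exp (-((∫⁻ z in Ioc c η, G z : ℝ≥0∞) : EReal)))) :=
    ((ENNReal.continuous_exp.comp continuous_neg).comp continuous_coe_ennreal_ereal).tendsto _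
      |>.comp hJ
  have hprod := ENNReal.Tendsto.mul hFu (Or.inl one_ne_zero) hE (Or.inr ENNReal.one_ne_top)
  rw [one_mul] at hprod
  exact tendsto_nhds_unique (tendsto_const_nhds.congr hstep) hprod

end ODE

/-! ### The law of the maximum drawdown -/

theorem leftEnd_le {I : Set ℝ} {z : ℝ} (hz : z ∈ I) : leftEnd I ≤ z :=
  sInf_le ⟨z, hz, rfl⟩

namespace IsRegularDiffusion

variable {Ω : Type*} [MeasurableSpace Ω] {I : Set ℝ} {X : ℝ≥0 → Ω → EReal} {P : ℝ → Measure Ω}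
  {S : ℝ → ℝ} {x y z c η : ℝ}

theorem mem_of_leftEnd_lt (hX : IsRegularDiffusion I X P) (h : leftEnd I < z) : z ∈ I := by
  obtain ⟨_, ⟨u, hu, rfl⟩, huz⟩ := sInf_lt_iff.1 h
  exact hX.mem_of_le hu (EReal.coe_le_coe_iff.1 huz.le)

theorem Ioi_subset_interior (hX : IsRegularDiffusion I X P) (hc : leftEnd I ≤ c) :
    Ioi c ⊆ interior I :=
  interior_maximal (fun _ hz => hX.mem_of_leftEnd_lt
    (lt_of_le_of_lt hc (EReal.coe_lt_coe_iff.2 hz))) isOpen_Ioi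

theorem leftEnd_le_path (hX : IsRegularDiffusion I X P) (t : ℝ≥0) (ω : Ω) :
    leftEnd I ≤ X t ω := by
  rcases hX.state t ω with h | ⟨z, hz, h⟩
  · rw [h]; exact le_top
  · rw [h]; exact leftEnd_le hz

theorem hasDerivAt_scale (hS1 : ContDiffOn ℝ 1 S (interior I)) (hz : z ∈ interior I) :
    HasDerivAt S (deriv S z) z :=
  ((hS1.differentiableOn one_ne_zero).differentiableAt
    (isOpen_interior.mem_nhds hz)).hasDerivAt

/-- At `y = 0` the density has a zero denominator, and its numerator is positive somewhere because
`S` increases. -/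
theorem drawdownIntegral_zero (hX : IsRegularDiffusion I X P) (hS : IsScaleFunction I X P S)
    (hS1 : ContDiffOn ℝ 1 S (interior I)) (hx : x ∈ I) (hxη : x < η) :
    drawdownIntegral I S x η 0 = ⊤ := by
  have hint : Ioi x ⊆ interior I := hX.Ioi_subset_interior (leftEnd_le hx)
  obtain ⟨z₀, hz₀, he⟩ := exists_deriv_eq_slope S hxη
    (hS.continuousOn.mono fun z hz => hX.mem_of_le hx hz.1)
    (fun z hz => (hasDerivAt_scale hS1 (hint hz.1)).differentiableAt.differentiableWithinAt)
  have hpos : 0 < deriv S z₀ := by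
    rw [he]
    exact div_pos (sub_pos.2 (hS.strictMonoOn hx (hX.mem_of_le hx hxη.le) hxη)) (sub_pos.2 hxη)
  have hcont : ContinuousAt (deriv S) z₀ :=
    (hS1.continuousOn_deriv_of_isOpen isOpen_interior le_rfl).continuousAt
      (isOpen_interior.mem_nhds (hint hz₀.1))
  obtain ⟨a, b, hab, hsub⟩ := mem_nhds_iff_exists_Ioo_subset.1
    ((hcont.eventually_const_lt hpos).and (Ioo_mem_nhds hz₀.1 hz₀.2))
  refine top_le_iff.1 ?_
  calc (⊤ : ℝ≥0∞) = ∫⁻ _ in Ioo a b, ⊤ := by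
        rw [setLIntegral_const, Real.volume_Ioo, ENNReal.top_mul]
        simpa using hab.1.trans hab.2
    _ ≤ ∫⁻ z in Ioo a b, ENNReal.ofReal (deriv S z) / ENNReal.ofReal (S z - S (z - 0)) := by
        refine setLIntegral_mono' measurableSet_Ioo fun z hz => ?_
        rw [sub_zero, sub_self, ENNReal.ofReal_zero,
          ENNReal.div_zero (by simpa using (hsub hz).1)]
    _ ≤ _ := by
        refine lintegral_mono_set fun z hz => ⟨?_, (hsub hz).2.2.le⟩
        rw [EReal.coe_zero, zero_add, max_eq_left (leftEnd_le hx)]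
        exact_mod_cast (hsub hz).2.1

theorem measure_drawdownEvent_eq_one (hX : IsRegularDiffusion I X P) (hx : x ∈ I) (hy : 0 < y)
    (hxc : x ≤ c) (hit : ∀ᵐ ω ∂P x, hitTime X c ω < ⊤)
    (hc : c = x ∨ leftEnd I = ((c - y : ℝ) : EReal)) :
    P x (drawdownEvent X x y c) = 1 := by
  have := hX.prob x hx
  rw [← measure_univ (μ := P x)]
  refine measure_congr (eventuallyEq_univ.2 ?_)
  filter_upwards [hX.start x hx, hit] with ω h0 hω
  refine ⟨h0, ?_⟩
  rcases hc with rfl | hl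
  · exact drawdownBelow_self hy h0
  · obtain ⟨t, ht⟩ := hitTime_lt_top_iff.1 hω
    exact drawdownBelow_of_lower_bound (a := c - y) (hX.continuous ω) (fun t => hX.ne_bot t ω) hy
      (by rw [h0]; exact_mod_cast hxc) (fun t => hl ▸ hX.leftEnd_le_path t ω) (by linarith) ht

/-- The drawdown formula, with the integral starting at the lowest level `c` from which a drawdown
of size `y` is possible. -/
theorem measure_drawdownEvent_eq_exp (hX : IsRegularDiffusion I X P)
    (hS : IsScaleFunction I X P S) (hS1 : ContDiffOn ℝ 1 S (interior I)) (hx : x ∈ I) (hy : 0 < y)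
    (hxc : x ≤ c) (hcη : c < η) (hlc : leftEnd I ≤ ((c - y : ℝ) : EReal))
    (hone : P x (drawdownEvent X x y c) = 1) :
    P x (drawdownEvent X x y η) = EReal.exp (-((∫⁻ z in Ioc c η,
      ENNReal.ofReal (deriv S z) / ENNReal.ofReal (S z - S (z - y)) : ℝ≥0∞) : EReal)) := by
  have := hX.prob x hx
  have hint : Ioi (c - y) ⊆ interior I := hX.Ioi_subset_interior hlc
  have hI : Ioi (c - y) ⊆ I := hint.trans interior_subset
  have hm : ∀ {u v}, c - y < u → u < v → S u < S v := fun hu huv =>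
    hS.strictMonoOn (hI hu) (hI (hu.trans huv)) huv
  have hint' : Ioi c ⊆ interior I := (Ioi_subset_Ioi (by linarith)).trans hint
  have key := exp_neg_lintegral_of_ratio_bounds (S := S)
    (F := fun z => (P x (drawdownEvent X x y z)).toReal) hy (hS.continuousOn.mono hI)
    (hS.strictMonoOn.mono hI) (fun z hz => hasDerivAt_scale hS1 (hint' hz))
    ((hS1.continuousOn_deriv_of_isOpen isOpen_interior le_rfl).mono hint') hcη
    (fun z _ => ENNReal.toReal_nonneg)
    (fun z _ => ENNReal.toReal_le_of_le_ofReal zero_le_one (by simpa using prob_le_one))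
    (by simp [hone])
    (fun z z' hz hzz' hz' => by
      have h := ENNReal.toReal_mono (ENNReal.mul_ne_top ENNReal.ofReal_ne_top (measure_ne_top _ _))
        (hX.measure_drawdownEvent_le hS hx hy (hxc.trans hz.le) hzz'.le
        (hI (show c - y < z - y by linarith)))
      rwa [ENNReal.toReal_mul, ENNReal.toReal_ofReal] at h
      have h1 : S (z - y) < S z := hm (by linarith) (by linarith)
      have h2 : S z < S z' := hm (by linarith) hzz'
      exact div_nonneg (by linarith) (by linarith))
    (fun z z' hz hzz' hz' hzy => by
      have h := ENNReal.toReal_mono (measure_ne_top _ _)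
        (hX.le_measure_drawdownEvent hS hx hy (hxc.trans hz) hzz'.le
        (hI (show c - y < z' - y by linarith)) hzy)
      rwa [ENNReal.toReal_mul, ENNReal.toReal_ofReal] at h
      have h1 : S (z' - y) < S z := hm (by linarith) (by linarith)
      have h2 : S z < S z' := hm (by linarith) hzz'
      exact div_nonneg (by linarith) (by linarith))
  rwa [ENNReal.ofReal_toReal (measure_ne_top _ _)] at key

end IsRegularDiffusion

/-- The level `x ∨ (y + l)` as a real number. -/
theorem exists_real_max_add_leftEnd {I : Set ℝ} {x η y : ℝ} (hx : x ∈ I) (hxη : x < η)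
    (hyη : (y : EReal) ≤ (η : EReal) - leftEnd I) :
    ∃ c : ℝ, max (x : EReal) ((y : EReal) + leftEnd I) = c ∧ x ≤ c ∧ c ≤ η ∧
      leftEnd I ≤ ((c - y : ℝ) : EReal) ∧ (c = x ∨ leftEnd I = ((c - y : ℝ) : EReal)) := by
  have hl := leftEnd_le hx
  induction hL : leftEnd I with
  | bot => exact ⟨x, by simp, le_rfl, hxη.le, bot_le, Or.inl rfl⟩
  | top => rw [hL] at hl; simp at hl
  | coe l =>
    rw [hL] at hyη
    have h1 : y ≤ η - l := by exact_mod_cast hyη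
    refine ⟨max x (y + l), rfl, le_max_left _ _, max_le hxη.le (by linarith), ?_, ?_⟩
    · have := le_max_right x (y + l)
      exact_mod_cast (by linarith : l ≤ max x (y + l) - y)
    · rcases le_total x (y + l) with h | h
      · right
        rw [max_eq_right h]
        exact_mod_cast (by ring : l = y + l - y)
      · exact Or.inl (max_eq_left h)

theorem theorem3p4 {Ω : Type*} [MeasurableSpace Ω] (I : Set ℝ)
    (X : ℝ≥0 → Ω → EReal) (P : ℝ → Measure Ω) (S : ℝ → ℝ)
    (hX : IsRegularDiffusion I X P)
    (hS : IsScaleFunction I X P S)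
    (hS1 : ContDiffOn ℝ 1 S (interior I))
    (hclass : IsClassOne I X P S ∨ IsClassTwo I X P S)
    (x η : ℝ) (hx : x ∈ I) (hxη : x < η) :
    (∀ᵐ ω ∂P x, hitTime X η ω < ⊤) ∧
    ∀ y : ℝ, 0 ≤ y → (y : EReal) ≤ (η : EReal) - leftEnd I →
      P x {ω | maxDrawdown X (hitTime X η ω) ω < (y : EReal)} =
        EReal.exp (-(drawdownIntegral I S x η y : EReal)) := by
  have hleft : LeftCondition I X P S := hclass.elim And.right And.right
  have hit : ∀ {z}, x < z → ∀ᵐ ω ∂P x, hitTime X z ω < ⊤ :=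
    fun hz => hX.ae_hitTime_lt_top hS hleft hx hz
  refine ⟨hit hxη, fun y hy hyη => ?_⟩
  rcases hy.eq_or_lt with rfl | hy
  · rw [hX.drawdownIntegral_zero hS hS1 hx hxη, EReal.coe_ennreal_top, EReal.neg_top,
      EReal.exp_bot]
    refine measure_eq_zero_iff_ae_notMem.2 ?_
    filter_upwards [hX.start x hx] with ω h0
    exact not_lt.2 (by simpa using maxDrawdown_nonneg h0 _)
  obtain ⟨c, hc, hxc, hcη, hlc, hor⟩ := exists_real_max_add_leftEnd hx hxη hyη
  have hone : P x (drawdownEvent X x y c) = 1 := by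
    refine hX.measure_drawdownEvent_eq_one hx hy hxc ?_ hor
    rcases hxc.eq_or_lt with rfl | hlt
    · filter_upwards [hX.start x hx] with ω h0 using hitTime_lt_top_iff.2 ⟨0, h0⟩
    · exact hit hlt
  have hev : P x {ω | maxDrawdown X (hitTime X η ω) ω < (y : EReal)} =
      P x (drawdownEvent X x y η) := by
    refine measure_congr (eventuallyEq_set.2 ?_)
    filter_upwards [hX.start x hx, hit hxη] with ω h0 hω
    refine (maxDrawdown_lt_iff (hX.continuous ω) (fun t => hX.ne_bot t ω)
      (by rw [h0]; exact_mod_cast hxη.le) hω).trans ?_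
    exact ⟨fun h => ⟨h0, h⟩, fun h => h.2⟩
  have hset : {z : ℝ | max (x : EReal) ((y : EReal) + leftEnd I) < (z : EReal) ∧ z ≤ η} =
      Ioc c η := by
    ext z
    simp only [hc, mem_ofPred_eq, mem_Ioc, EReal.coe_lt_coe_iff]
  rw [hev, drawdownIntegral, hset]
  rcases hcη.eq_or_lt with rfl | hlt
  · simp [hone]
  · exact hX.measure_drawdownEvent_eq_exp hS hS1 hx hy hxc hlt hlc hone
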